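/- Comparison principle for the dual BBGKY hierarchy of hard spheres. Let $d\ge 2$, $N\ge 1$, $\varepsilon>0$. For $1\le s\le N$ write $Z_s=(X_s,V_s)=(z_1,\dots,z_s)$, $z_i=(x_i,v_i)\in\mathbb R^d\times\mathbb R^d$, and let $$\mathcal D_s=\{Z_s:\ |x_i-x_j|>\varepsilon\ \text{ for all } 1\le i<j\le s\}.$$ For $i\neq j$ let $\Gamma_s(i,j)\subset\partial\mathcal D_s$ be the set of $Z_s$ with $|x_i-x_j|=\varepsilon$ and $|x_k-x_l|>\varepsilon$ for every other pair $\{k,l\}$, and let $\Gamma_s^{\rm post}(i,j)$ be the set of $Z_s\in\Gamma_s(i,j)$ with $(x_j-x_i)\cdot(v_j-v_i)>0$. For $Z_s\in\Gamma_s(i,j)$ with $x_j=x_i+\varepsilon\omega$, let $Z_s^*$ be obtained from $Z_s$ by replacing $v_i,v_j$ with $v_i^*=v_i+\omega\,\omega\cdot(v_j-v_i)$ and $v_j^*=v_j-\omega\,\omega\cdot(v_j-v_i)$; let $Z_s^{(i)}$ be $Z_s$ with the particle $z_i$ removed. Let $\phi_N^{(s)}$ and $\hat\phi_N^{(s)}$,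 $1\le s\le N$, be real-valued functions of $t\ge 0$ and $Z_s$ (in $\mathcal D_s$ and on its boundary), symmetric under interchange of particles, such that both satisfy, for $1\le s\le N$, the transport equation $$(\partial_t-V_s\cdot\nabla_{X_s})\phi^{(s)}(t,Z_s)=0\quad (Z_s\in\mathcal D_s),$$ in the sense that for all $t,h\ge 0$ one has $\phi^{(s)}(t+h,X_s,V_s)=\phi^{(s)}(t,X_s+hV_s,V_s)$ whenever $(X_s+\sigma V_s,V_s)\in\mathcal D_s$ for all $0<\sigma<h$ (so that boundary values are traces along characteristics), and, for $2\le s\le N$, $t>0$ and all $i\ne j$, the jump conditions: for the dual BBGKY hierarchy $$\frac{\phi_N^{(s)}(t,Z_s^*)}{N-s+1}+\phi_N^{(s-1)}(t,(Z_s^*)^{(i)})+\phi_N^{(s-1)}(t,(Z_s^*)^{(j)})=\frac{\phi_N^{(s)}(t,Z_s)}{N-s+1}+\phi_N^{(s-1)}(t,Z_s^{(i)})+\phi_N^{(s-1)}(t,Z_s^{(j)})$$ for every $Z_s\in\Gamma_s(i,j)$, and for the modified hierarchy $$\frac{\hat\phi_N^{(s)}(t,Z_s^*)}{N-s+1}-\hat\phi_N^{(s-1)}(t,(Z_s^*)^{(i)})-\hat\phi_N^{(s-1)}(t,(Z_s^*)^{(j)})=\frac{\hat\phi_N^{(s)}(t,Z_s)}{N-s+1}+\hat\phi_N^{(s-1)}(t,Z_s^{(i)})+\hat\phi_N^{(s-1)}(t,Z_s^{(j)})$$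 for every $Z_s\in\Gamma_s^{\rm post}(i,j)$. Let $1\le S\le N$ and suppose that for all $1\le s\le S$ $$|\phi_N^{(s)}(0,Z_s)|\le\hat\phi_N^{(s)}(0,Z_s)\quad\text{for almost every } Z_s\in\mathcal D_s.$$ Then for all $t\ge 0$ and all $1\le s\le S$ $$|\phi_N^{(s)}(t,Z_s)|\le\hat\phi_N^{(s)}(t,Z_s)\quad\text{for almost every } Z_s\in\mathcal D_s.$$ -/

import Mathlib

namespace HardSphere

/-- Configurations `Z_s = (z_1, …, z_s)` of `s` particles in `ℝ^d`, where `z_i = (x_i, v_i)`: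
`(Z i).1` is the position and `(Z i).2` the velocity of the particle `i`. It carries
Lebesgue measure on `ℝ^{2ds}`. -/
abbrev Config (d s : ℕ) : Type :=
  Fin s → EuclideanSpace ℝ (Fin d) × EuclideanSpace ℝ (Fin d)

variable {d s : ℕ}

/-- The open phase space `𝒟_s` of `s` hard spheres of diameter `ε`. -/
def phaseSpace (d s : ℕ) (ε : ℝ) : Set (Config d s) :=
  {Z | ∀ i j : Fin s, i < j → ε < ‖(Z i).1 - (Z j).1‖}

/-- Free motion for a time `h`: `(X_s, V_s) ↦ (X_s + h V_s, V_s)`. -/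
def freeFlow (h : ℝ) (Z : Config d s) : Config d s :=
  fun i => ((Z i).1 + h • (Z i).2, (Z i).2)

/-- Points of `∂𝒟_s` at which the particles `i ≠ j`, and no other pair, are in contact
(the set `(Σ_s(i,j) × ℝ^{ds}) ∩ ∂𝒟_s`). -/
def contactSet (d s : ℕ) (ε : ℝ) (i j : Fin s) : Set (Config d s) :=
  {Z | i ≠ j ∧ ‖(Z i).1 - (Z j).1‖ = ε ∧
    ∀ k l : Fin s, k ≠ l → ¬ (k = i ∧ l = j) → ¬ (k = j ∧ l = i) →
      ε < ‖(Z k).1 - (Z l).1‖}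

/-- The post-collisional points of `contactSet d s ε i j`: the two particles in contact are
moving apart. -/
def postContactSet (d s : ℕ) (ε : ℝ) (i j : Fin s) : Set (Config d s) :=
  {Z | Z ∈ contactSet d s ε i j ∧ 0 < inner ℝ ((Z j).1 - (Z i).1) ((Z j).2 - (Z i).2)}

/-- The collisional change of variables `Z_s ↦ Z_s^*` for particles with
`x_j = x_i + ε ω`: `v_i^* = v_i + ω (ω · (v_j - v_i))`, `v_j^* = v_j - ω (ω · (v_j - v_i))`. -/
noncomputable def collide (ε : ℝ) (i j : Fin s) (Z : Config d s) : Config d s :=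
  let ω : EuclideanSpace ℝ (Fin d) := ε⁻¹ • ((Z j).1 - (Z i).1)
  let p : EuclideanSpace ℝ (Fin d) := inner ℝ ω ((Z j).2 - (Z i).2) • ω
  fun k =>
    if k = i then ((Z i).1, (Z i).2 + p)
    else if k = j then ((Z j).1, (Z j).2 - p)
    else Z k

/-- `Z_{s+1}^{(i)}`: the configuration with the particle `i` removed. -/
def removeParticle (i : Fin (s + 1)) (Z : Config d (s + 1)) : Config d s :=
  fun k => Z (i.succAbove k)

/-- Symmetry of `φ` on `𝒟_s` under interchange of particles. -/
def IsSymmetric (ε : ℝ) (φ : Config d s → ℝ) : Prop :=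
  ∀ σ : Equiv.Perm (Fin s), ∀ Z ∈ phaseSpace d s ε, φ (fun k => Z (σ k)) = φ Z

/-- The equation `(∂_t - V_s · ∇_{X_s}) φ = 0` in `𝒟_s` for `t ≥ 0`, along characteristics:
`φ` is constant along every free trajectory inside `𝒟_s`. The end points of the
trajectory may lie on `∂𝒟_s`; this says that the value of `φ` at a boundary point is its trace
along the characteristic. -/
def SolvesTransport (ε : ℝ) (φ : ℝ → Config d s → ℝ) : Prop :=
  ∀ t h : ℝ, 0 ≤ t → 0 ≤ h → ∀ Z : Config d s,
    (∀ σ : ℝ, 0 < σ → σ < h → freeFlow σ Z ∈ phaseSpace d s ε) →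
      φ (t + h) Z = φ t (freeFlow h Z)

/-- `Φ = {φ^{(s)}}_{1 ≤ s ≤ N}`, for `t ≥ 0`, is a symmetric solution of the dual BBGKY hierarchy
of `N` hard spheres of diameter `ε`. The values `φ s` with `s = 0` or `s > N` play no role. In
the jump condition the level is `s + 1`, so that the weight `N - (s + 1) + 1` is `N - s`. -/
structure IsDualBBGKYSolution (d N : ℕ) (ε : ℝ) (φ : (s : ℕ) → ℝ → Config d s → ℝ) : Prop where
  symm : ∀ s : ℕ, 1 ≤ s → s ≤ N → ∀ t : ℝ, 0 ≤ t → IsSymmetric ε (φ s t)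
  transport : ∀ s : ℕ, 1 ≤ s → s ≤ N → SolvesTransport ε (φ s)
  jump : ∀ s : ℕ, 1 ≤ s → s + 1 ≤ N → ∀ t : ℝ, 0 < t → ∀ i j : Fin (s + 1),
    ∀ Z ∈ contactSet d (s + 1) ε i j,
      φ (s + 1) t (collide ε i j Z) / ((N : ℝ) - s)
          + φ s t (removeParticle i (collide ε i j Z))
          + φ s t (removeParticle j (collide ε i j Z))
        = φ (s + 1) t Z / ((N : ℝ) - s)
          + φ s t (removeParticle i Z) + φ s t (removeParticle j Z)

/-- `{φ̂^{(s)}}_{1 ≤ s ≤ N}`, for `t ≥ 0`, is a symmetric solution of the modified hierarchy: the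
jump condition is imposed at post-collisional `Z`, and the lower-order terms at the
pre-collisional `Z^*` carry a minus sign. -/
structure IsModifiedSolution (d N : ℕ) (ε : ℝ) (φ : (s : ℕ) → ℝ → Config d s → ℝ) : Prop where
  symm : ∀ s : ℕ, 1 ≤ s → s ≤ N → ∀ t : ℝ, 0 ≤ t → IsSymmetric ε (φ s t)
  transport : ∀ s : ℕ, 1 ≤ s → s ≤ N → SolvesTransport ε (φ s)
  jump : ∀ s : ℕ, 1 ≤ s → s + 1 ≤ N → ∀ t : ℝ, 0 < t → ∀ i j : Fin (s + 1),
    ∀ Z ∈ postContactSet d (s + 1) ε i j,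
      φ (s + 1) t (collide ε i j Z) / ((N : ℝ) - s)
          - φ s t (removeParticle i (collide ε i j Z))
          - φ s t (removeParticle j (collide ε i j Z))
        = φ (s + 1) t Z / ((N : ℝ) - s)
          + φ s t (removeParticle i Z) + φ s t (removeParticle j Z)

end HardSphere

/-! Induction on the number of particles. Follow the hard-sphere trajectory issuing from `Z` while
the time argument of `φ` runs down from `t` to `0`. On a free segment transport makes both functions
constant. At a collision the trajectory arrives at a pre-collisional point and leaves from the
post-collisional one, and the jump conditions express the first value by the second plus four terms
with one particle fewer. For `φ` these terms carry mixed signs; in the modified hierarchy all four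
enter with weight `+(N - s)`, so bounds on the post-collisional value and on the lower terms add up
(`abs_le_of_jump`). After finitely many collisions the initial data are reached.

Two points need care. Collisions must not accumulate before `t`: `no_accumulation_of_collisions`
shows this by a monotone quantity that vanishes only on a straight line. And bounds hold only almost
everywhere, so the trajectory must avoid null sets. Trajectories are labelled by the time-`0`
configuration of their current free segment; collision preimages of null sets are null, so a bad
null set can be enlarged to one that no outside trajectory enters
(`exists_null_superset_closed_under_collisions`). Collision times depend on `Z`, but the lower-order
bounds are needed only at rational times, since each free segment contains one and transport carries
the bound to its ends (`abs_le_of_forall_rat`). -/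

namespace HardSphere

open MeasureTheory Filter Topology

variable {d s : ℕ}

/-! ### Non-accumulation of velocity changes in a Hilbert space -/

/-- A piecewise linear trajectory of constant speed whose velocity changes point away from every
limit position cannot have an accumulation of velocity changes. -/
theorem no_accumulation_of_velocity_changes {H : Type*} [NormedAddCommGroup H]
    [InnerProductSpace ℝ H] [CompleteSpace H] {T : ℕ → ℝ} {X V : ℕ → H} {b c : ℝ}
    (hT : StrictMono T) (hb : ∀ k, T k ≤ b) (hV : ∀ k, ‖V k‖ = c)
    (hX : ∀ k, X (k + 1) = X k + (T (k + 1) - T k) • V k) (hne : ∀ k, V (k + 1) ≠ V k)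
    (hI : ∀ x, Tendsto X atTop (𝓝 x) →
      ∀ᶠ k in atTop, inner ℝ (V (k + 1) - V k) (x - X (k + 1)) ≤ 0) : False := by
  have hbdd : BddAbove (Set.range T) := ⟨b, by rintro _ ⟨k, rfl⟩; exact hb k⟩
  have hTlim := tendsto_atTop_ciSup hT.monotone hbdd
  set τ := ⨆ k, T k with hτ
  have hTle : ∀ k, T k ≤ τ := fun k => le_ciSup hbdd k
  have hTlt : ∀ k, T k < τ := fun k => (hT k.lt_succ_self).trans_le (hTle _)
  have hc : 0 ≤ c := by rw [← hV 0]; exact norm_nonneg _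
  have hdist : ∀ n m, n ≤ m → dist (X n) (X m) ≤ c * (T m - T n) := by
    intro n m hnm
    induction m, hnm using Nat.le_induction with
    | base => simp
    | succ m _ ih =>
      have h1 : dist (X m) (X (m + 1)) = c * (T (m + 1) - T m) := by
        rw [hX, dist_self_add_right, norm_smul, hV, Real.norm_of_nonneg, mul_comm]
        exact sub_nonneg.2 (hT m.lt_succ_self).le
      have h2 := dist_triangle (X n) (X m) (X (m + 1))
      linarith
  have hb0 : Tendsto (fun n => c * (τ - T n)) atTop (𝓝 0) := by
    have := (tendsto_const_nhds (x := τ)).sub hTlim |>.const_mul c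
    simpa using this
  have hcau : CauchySeq X := cauchySeq_of_le_tendsto_0' _
    (fun n m hnm => (hdist n m hnm).trans
      (mul_le_mul_of_nonneg_left (sub_le_sub_right (hTle m) _) hc)) hb0
  obtain ⟨x, hx⟩ := cauchySeq_tendsto_of_complete hcau
  have hxX : ∀ k, ‖x - X k‖ ≤ c * (τ - T k) := by
    intro k
    have h1 : Tendsto (fun m => dist (X k) (X m)) atTop (𝓝 (dist (X k) x)) :=
      tendsto_const_nhds.dist hx
    rw [← dist_eq_norm, dist_comm]
    refine le_of_tendsto h1 (eventually_atTop.2 ⟨k, fun m hm => (hdist k m hm).trans ?_⟩)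
    exact mul_le_mul_of_nonneg_left (sub_le_sub_right (hTle m) _) hc
  obtain ⟨K, hK⟩ := eventually_atTop.1 (hI x hx)
  -- `F k` is the deficit in Cauchy–Schwarz between the velocity and the remaining displacement. It
  -- is nonpositive, does not increase at velocity changes by `hI`, and tends to `0`; so it vanishes
  -- from `K` on.
  set F : ℕ → ℝ := fun k => inner ℝ (V k) (x - X k) - c ^ 2 * (τ - T k) with hF
  have hFle : ∀ k, F k ≤ 0 := by
    intro k
    have h1 := real_inner_le_norm (V k) (x - X k)
    rw [hV] at h1
    have h2 := mul_le_mul_of_nonneg_left (hxX k) hc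
    simp only [hF]; nlinarith
  have hstep : ∀ k, K ≤ k → F (k + 1) ≤ F k := by
    intro k hk
    have h1 := hK k hk
    have h2 : x - X k = (x - X (k + 1)) + (T (k + 1) - T k) • V k := by rw [hX]; abel
    simp only [hF]
    rw [h2, inner_add_right, inner_smul_right, real_inner_self_eq_norm_sq, hV]
    rw [inner_sub_left] at h1
    nlinarith
  have hFlim : Tendsto F atTop (𝓝 0) := by
    have h1 : Tendsto (fun k => inner ℝ (V k) (x - X k)) atTop (𝓝 0) := by
      have h2 : Tendsto (fun k => c * (c * (τ - T k))) atTop (𝓝 0) := by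
        simpa using hb0.const_mul c
      refine squeeze_zero_norm (fun k => ?_) h2
      have h3 := norm_inner_le_norm (𝕜 := ℝ) (V k) (x - X k)
      rw [hV] at h3
      exact h3.trans (mul_le_mul_of_nonneg_left (hxX k) hc)
    have h2 : Tendsto (fun k => c ^ 2 * (τ - T k)) atTop (𝓝 0) := by
      have := hb0.const_mul c
      simpa [pow_two, mul_assoc] using this
    simpa [hF] using h1.sub h2
  have hF0 : ∀ k, K ≤ k → F k = 0 := by
    intro k hk
    refine le_antisymm (hFle k) ?_
    refine le_of_tendsto hFlim (eventually_atTop.2 ⟨k, fun m hm => ?_⟩)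
    induction m, hm using Nat.le_induction with
    | base => exact le_rfl
    | succ m hm ih => exact (hstep m (hk.trans hm)).trans ih
  -- Equality in Cauchy–Schwarz: the motion heads straight for `x`. Applied to two successive
  -- segments, this forces equal velocities.
  have hline : ∀ k, K ≤ k → x - X k = (τ - T k) • V k := by
    intro k hk
    have h1 : inner ℝ (V k) (x - X k) = c ^ 2 * (τ - T k) := by
      have := hF0 k hk; simp only [hF] at this; linarith
    have h2 : ‖x - X k - (τ - T k) • V k‖ ^ 2 ≤ 0 := by
      rw [norm_sub_sq_real, inner_smul_right, real_inner_comm, h1, norm_smul, hV,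
        Real.norm_of_nonneg (sub_nonneg.2 (hTle k))]
      have h3 := pow_le_pow_left₀ (norm_nonneg _) (hxX k) 2
      nlinarith
    have h3 : ‖x - X k - (τ - T k) • V k‖ = 0 := by
      have := le_antisymm h2 (sq_nonneg _)
      exact pow_eq_zero_iff (two_ne_zero) |>.1 this
    exact sub_eq_zero.1 (norm_eq_zero.1 h3)
  refine hne K ?_
  have h1 := hline K le_rfl
  have h2 := hline (K + 1) (Nat.le_succ K)
  rw [hX, ← sub_sub, h1, ← sub_smul, sub_sub_sub_cancel_right] at h2
  exact (smul_right_injective H (sub_pos.2 (hTlt (K + 1))).ne' h2).symm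

/-! ### Kinematics of free flow and binary collisions -/

theorem freeFlow_freeFlow (a b : ℝ) (Z : Config d s) :
    freeFlow a (freeFlow b Z) = freeFlow (a + b) Z := by
  funext k
  simp only [freeFlow, add_smul]
  congr 1
  abel

@[simp] theorem freeFlow_zero (Z : Config d s) : freeFlow 0 Z = Z := by
  funext k
  simp [freeFlow]

@[simp] theorem freeFlow_snd (a : ℝ) (Z : Config d s) (k : Fin s) :
    (freeFlow a Z k).2 = (Z k).2 := rfl

theorem removeParticle_freeFlow (a : ℝ) (i : Fin (s + 1)) (Z : Config d (s + 1)) :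
    removeParticle i (freeFlow a Z) = freeFlow a (removeParticle i Z) := rfl

theorem removeParticle_mem_phaseSpace {ε : ℝ} (i : Fin (s + 1)) {Z : Config d (s + 1)}
    (hZ : Z ∈ phaseSpace d (s + 1) ε) : removeParticle i Z ∈ phaseSpace d s ε :=
  fun _ _ hkl => hZ _ _ (Fin.strictMono_succAbove i hkl)

theorem mem_phaseSpace_iff {ε : ℝ} {Z : Config d s} :
    Z ∈ phaseSpace d s ε ↔ ∀ i j, i ≠ j → ε < ‖(Z j).1 - (Z i).1‖ := by
  refine ⟨fun h i j hij => ?_, fun h i j hij => h j i hij.ne'⟩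
  rcases lt_or_gt_of_ne hij with h1 | h1
  · rw [norm_sub_rev]; exact h i j h1
  · exact h j i h1

/-- The pair `(i, j)` is in contact and approaching. -/
def IsIncoming (ε : ℝ) (i j : Fin s) (Z : Config d s) : Prop :=
  i ≠ j ∧ ‖(Z j).1 - (Z i).1‖ = ε ∧ inner ℝ ((Z j).1 - (Z i).1) ((Z j).2 - (Z i).2) < 0

@[simp] theorem collide_fst (ε : ℝ) (i j : Fin s) (Z : Config d s) (k : Fin s) :
    (collide ε i j Z k).1 = (Z k).1 := by
  unfold collide
  split_ifs with h1 h2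
  · rw [h1]
  · rw [h2]
  · rfl

/-- The momentum transferred to the particle `i` in a collision with `j`. -/
noncomputable def impulse (ε : ℝ) (i j : Fin s) (Z : Config d s) : EuclideanSpace ℝ (Fin d) :=
  inner ℝ (ε⁻¹ • ((Z j).1 - (Z i).1)) ((Z j).2 - (Z i).2) • (ε⁻¹ • ((Z j).1 - (Z i).1))

theorem collide_snd_left (ε : ℝ) (i j : Fin s) (Z : Config d s) :
    (collide ε i j Z i).2 = (Z i).2 + impulse ε i j Z := by
  simp [collide, impulse]

theorem collide_snd_right {ε : ℝ} {i j : Fin s} (hij : i ≠ j) (Z : Config d s) :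
    (collide ε i j Z j).2 = (Z j).2 - impulse ε i j Z := by
  simp [collide, impulse, hij.symm]

theorem collide_of_ne {ε : ℝ} {i j k : Fin s} (hi : k ≠ i) (hj : k ≠ j) (Z : Config d s) :
    collide ε i j Z k = Z k := by
  simp [collide, hi, hj]

theorem collide_relVel {ε : ℝ} {i j : Fin s} (hij : i ≠ j) (Z : Config d s) :
    (collide ε i j Z j).2 - (collide ε i j Z i).2
      = ((Z j).2 - (Z i).2) - (2 : ℝ) • impulse ε i j Z := by
  rw [collide_snd_left, collide_snd_right hij, two_smul]
  abel

theorem impulse_eq (ε : ℝ) (i j : Fin s) (Z : Config d s) :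
    impulse ε i j Z = ((ε⁻¹) ^ 2 * inner ℝ ((Z j).1 - (Z i).1) ((Z j).2 - (Z i).2)) •
      ((Z j).1 - (Z i).1) := by
  rw [impulse, inner_smul_left, smul_smul]
  congr 1
  simp
  ring

theorem inner_collide_relVel {ε : ℝ} (hε : 0 < ε) {i j : Fin s} (hij : i ≠ j) {Z : Config d s}
    (hZ : ‖(Z j).1 - (Z i).1‖ = ε) :
    inner ℝ ((Z j).1 - (Z i).1) ((collide ε i j Z j).2 - (collide ε i j Z i).2)
      = - inner ℝ ((Z j).1 - (Z i).1) ((Z j).2 - (Z i).2) := by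
  rw [collide_relVel hij, impulse_eq, inner_sub_right, inner_smul_right, inner_smul_right,
    real_inner_self_eq_norm_sq, hZ]
  field_simp
  ring

theorem impulse_collide {ε : ℝ} (hε : 0 < ε) {i j : Fin s} (hij : i ≠ j) {Z : Config d s}
    (hZ : ‖(Z j).1 - (Z i).1‖ = ε) : impulse ε i j (collide ε i j Z) = - impulse ε i j Z := by
  rw [impulse_eq, impulse_eq, collide_fst, collide_fst, inner_collide_relVel hε hij hZ,
    mul_neg, neg_smul]

theorem collide_collide {ε : ℝ} (hε : 0 < ε) {i j : Fin s} (hij : i ≠ j) {Z : Config d s}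
    (hZ : ‖(Z j).1 - (Z i).1‖ = ε) : collide ε i j (collide ε i j Z) = Z := by
  funext k
  by_cases hi : k = i
  · subst hi
    refine Prod.ext (by simp) ?_
    rw [collide_snd_left, impulse_collide hε hij hZ, collide_snd_left]
    abel
  by_cases hj : k = j
  · subst hj
    refine Prod.ext (by simp) ?_
    rw [collide_snd_right hij, impulse_collide hε hij hZ, collide_snd_right hij]
    abel
  rw [collide_of_ne hi hj, collide_of_ne hi hj]

/-- All positions, as a point of a Euclidean space. -/
noncomputable def positions (Z : Config d s) :
    PiLp 2 (fun _ : Fin s => EuclideanSpace ℝ (Fin d)) := WithLp.toLp 2 fun k => (Z k).1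

/-- All velocities, as a point of a Euclidean space. -/
noncomputable def velocities (Z : Config d s) :
    PiLp 2 (fun _ : Fin s => EuclideanSpace ℝ (Fin d)) := WithLp.toLp 2 fun k => (Z k).2

@[simp] theorem positions_apply (Z : Config d s) (k : Fin s) : positions Z k = (Z k).1 := rfl

@[simp] theorem velocities_apply (Z : Config d s) (k : Fin s) : velocities Z k = (Z k).2 := rfl

theorem positions_freeFlow (a : ℝ) (Z : Config d s) :
    positions (freeFlow a Z) = positions Z + a • velocities Z := rfl

theorem velocities_freeFlow (a : ℝ) (Z : Config d s) :
    velocities (freeFlow a Z) = velocities Z := rfl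

theorem positions_collide (ε : ℝ) (i j : Fin s) (Z : Config d s) :
    positions (collide ε i j Z) = positions Z := by
  ext1 k
  simp

theorem inner_velocities_collide_sub {ε : ℝ} {i j : Fin s} (hij : i ≠ j) (Z : Config d s)
    (U : PiLp 2 (fun _ : Fin s => EuclideanSpace ℝ (Fin d))) :
    inner ℝ (velocities (collide ε i j Z) - velocities Z) U
      = - inner ℝ (impulse ε i j Z) (U j - U i) := by
  rw [PiLp.inner_apply, Finset.sum_eq_add i j hij]
  · simp only [PiLp.sub_apply, velocities_apply]
    rw [collide_snd_left, collide_snd_right hij, inner_sub_right]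
    simp only [add_sub_cancel_left, sub_sub_cancel_left, inner_neg_left]
    ring
  · rintro _ - ⟨hi, hj⟩
    simp [collide_of_ne hi hj]
  · simp
  · simp

/-- Conservation of kinetic energy: the impulse is parallel to the contact direction, along which
the relative velocity is reversed, so it is orthogonal to the sum of the old and new relative
velocities. -/
theorem norm_velocities_collide {ε : ℝ} (hε : 0 < ε) {i j : Fin s} (hij : i ≠ j) {Z : Config d s}
    (hZ : ‖(Z j).1 - (Z i).1‖ = ε) : ‖velocities (collide ε i j Z)‖ = ‖velocities Z‖ := by
  have h := inner_velocities_collide_sub (ε := ε) hij Z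
    (velocities (collide ε i j Z) + velocities Z)
  have h2 : inner ℝ (impulse ε i j Z) ((collide ε i j Z j).2 - (collide ε i j Z i).2
      + ((Z j).2 - (Z i).2)) = 0 := by
    rw [inner_add_right, impulse_eq, inner_smul_left, inner_smul_left,
      inner_collide_relVel hε hij hZ]
    ring
  have h3 : (velocities (collide ε i j Z) + velocities Z) j
      - (velocities (collide ε i j Z) + velocities Z) i
      = (collide ε i j Z j).2 - (collide ε i j Z i).2 + ((Z j).2 - (Z i).2) := by
    simp only [PiLp.add_apply, velocities_apply]
    abel
  rw [h3, h2, neg_zero, real_inner_comm, real_inner_add_sub_eq_zero_iff] at h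
  exact h

/-- The free trajectory (labelled by its configuration at time `0`) that continues the free
trajectory of `Z` after a collision of `i` and `j` at time `τ`. -/
noncomputable def recoil (ε : ℝ) (i j : Fin s) (τ : ℝ) (Z : Config d s) : Config d s :=
  freeFlow (-τ) (collide ε i j (freeFlow τ Z))

theorem freeFlow_recoil (ε : ℝ) (i j : Fin s) (τ : ℝ) (Z : Config d s) :
    freeFlow τ (recoil ε i j τ Z) = collide ε i j (freeFlow τ Z) := by
  simp [recoil, freeFlow_freeFlow]

theorem recoil_recoil {ε : ℝ} (hε : 0 < ε) {i j : Fin s} (hij : i ≠ j) {τ : ℝ} {Z : Config d s}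
    (hZ : ‖(freeFlow τ Z j).1 - (freeFlow τ Z i).1‖ = ε) :
    recoil ε i j τ (recoil ε i j τ Z) = Z := by
  rw [recoil, freeFlow_recoil, collide_collide hε hij hZ, freeFlow_freeFlow, neg_add_cancel,
    freeFlow_zero]

/-! ### Finiteness of the number of collisions in bounded time -/

/-- Collisions of hard spheres do not accumulate. -/
theorem no_accumulation_of_collisions {ε : ℝ} (hε : 0 < ε) {T : ℕ → ℝ} {W : ℕ → Config d s}
    {i j : ℕ → Fin s} {b : ℝ} (hT : StrictMono T) (hb : ∀ k, T k ≤ b)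
    (hin : ∀ k, IsIncoming ε (i k) (j k) (freeFlow (T (k + 1)) (W k)))
    (hW : ∀ k, W (k + 1) = recoil ε (i k) (j k) (T (k + 1)) (W k)) : False := by
  have hff : ∀ k, freeFlow (T (k + 1)) (W (k + 1))
      = collide ε (i k) (j k) (freeFlow (T (k + 1)) (W k)) := fun k => by
    rw [hW, freeFlow_recoil]
  have hvel : ∀ k, velocities (W (k + 1))
      = velocities (collide ε (i k) (j k) (freeFlow (T (k + 1)) (W k))) := fun k => by
    rw [← hff, velocities_freeFlow]
  have hpos : ∀ k, positions (freeFlow (T (k + 1)) (W (k + 1)))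
      = positions (freeFlow (T (k + 1)) (W k)) := fun k => by
    rw [hff, positions_collide]
  have hfst : ∀ k l, (freeFlow (T (k + 1)) (W (k + 1)) l).1
      = (freeFlow (T (k + 1)) (W k) l).1 := fun k l => by
    rw [hff, collide_fst]
  have himp : ∀ k U, inner ℝ (velocities (W (k + 1)) - velocities (W k)) U
      = - inner ℝ (impulse ε (i k) (j k) (freeFlow (T (k + 1)) (W k))) (U (j k) - U (i k)) :=
    fun k U => by
      rw [hvel, ← inner_velocities_collide_sub (hin k).1, velocities_freeFlow]
  have hcontact : ∀ k, ‖(freeFlow (T (k + 1)) (W (k + 1)) (j k)).1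
      - (freeFlow (T (k + 1)) (W (k + 1)) (i k)).1‖ = ε := fun k => by
    rw [hfst, hfst]; exact (hin k).2.1
  refine no_accumulation_of_velocity_changes (T := T) (c := ‖velocities (W 0)‖)
    (X := fun k => positions (freeFlow (T k) (W k))) (V := fun k => velocities (W k)) hT hb ?_ ?_ ?_
    ?_
  · intro k
    induction k with
    | zero => rfl
    | succ k ih =>
      rw [← ih, hvel, norm_velocities_collide hε (hin k).1 (hin k).2.1, velocities_freeFlow]
  · intro k
    rw [hpos, positions_freeFlow, positions_freeFlow, sub_smul]
    abel
  · intro k hk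
    -- Testing the velocity change against the incoming velocity gives a negative multiple of the
    -- squared normal relative velocity, which is nonzero.
    have h1 := himp k (velocities (freeFlow (T (k + 1)) (W k)))
    rw [hk, sub_self, inner_zero_left, velocities_apply, velocities_apply, impulse_eq,
      inner_smul_left] at h1
    have h2 := (hin k).2.2
    have h3 : 0 < (ε⁻¹) ^ 2 := by positivity
    have h4 := mul_pos h3 (mul_pos_of_neg_of_neg h2 h2)
    simp only [conj_trivial] at h1
    nlinarith
  · intro x hx
    have hx' : ∀ l, Tendsto (fun k => (freeFlow (T k) (W k) l).1) atTop (𝓝 (x l)) := fun l =>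
      ((PiLp.continuous_apply 2 _ l).tendsto x).comp hx
    -- There are finitely many pairs, and a pair that collides infinitely often is still in contact
    -- in the limit configuration.
    have hlim : ∀ e : Fin s × Fin s, ∀ᶠ k in atTop, (i k, j k) = e → ‖x e.2 - x e.1‖ = ε := by
      intro e
      by_cases hfr : ∃ᶠ k in atTop, (i k, j k) = e
      · refine Eventually.of_forall fun _ _ => ?_
        have h1 : Tendsto (fun k => ‖(freeFlow (T (k + 1)) (W (k + 1)) e.2).1
            - (freeFlow (T (k + 1)) (W (k + 1)) e.1).1‖) atTop (𝓝 ‖x e.2 - x e.1‖) :=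
          (((hx' e.2).sub (hx' e.1)).norm).comp (tendsto_add_atTop_nat 1)
        by_contra hne
        refine hfr ?_
        filter_upwards [h1.eventually_ne hne] with k hk he
        subst he
        exact hk (hcontact k)
      · filter_upwards [not_frequently.1 hfr] with k hk he
        exact absurd he hk
    filter_upwards [eventually_all.2 hlim] with k hk
    have hk := hk _ rfl
    simp only at hk ⊢
    rw [himp, impulse_eq, inner_smul_left]
    simp only [PiLp.sub_apply, positions_apply, hfst, conj_trivial]
    have h2 := (hin k).2.2
    have h5 := (hin k).2.1
    set p := (freeFlow (T (k + 1)) (W k) (j k)).1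
    set q := (freeFlow (T (k + 1)) (W k) (i k)).1
    -- Both relative positions have norm `ε`, so Cauchy–Schwarz bounds their inner product by `ε ^
    -- 2`.
    have h6 : inner ℝ (p - q) (x (j k) - p - (x (i k) - q)) ≤ 0 := by
      have h7 : x (j k) - p - (x (i k) - q) = (x (j k) - x (i k)) - (p - q) := by abel
      have h8 := real_inner_le_norm (p - q) (x (j k) - x (i k))
      rw [h7, inner_sub_right, real_inner_self_eq_norm_sq]
      rw [hk] at h8
      rw [h5] at h8 ⊢
      nlinarith
    have h3 : 0 < (ε⁻¹) ^ 2 := by positivity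
    have h9 := mul_neg_of_pos_of_neg h3 h2
    have := mul_nonneg_of_nonpos_of_nonpos h9.le h6
    linarith

/-! ### Contact times as functions of the free trajectory -/

instance :
    (volume : Measure (EuclideanSpace ℝ (Fin d) × EuclideanSpace ℝ (Fin d))).IsAddHaarMeasure :=
  inferInstanceAs ((volume : Measure (EuclideanSpace ℝ (Fin d))).prod volume).IsAddHaarMeasure

instance : SigmaFinite (volume : Measure (EuclideanSpace ℝ (Fin d) × EuclideanSpace ℝ (Fin d))) :=
  inferInstanceAs (SigmaFinite ((volume : Measure (EuclideanSpace ℝ (Fin d))).prod volume))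

instance : (volume : Measure (Config d s)).IsAddHaarMeasure :=
  inferInstanceAs (Measure.pi fun _ : Fin s => (volume :
    Measure (EuclideanSpace ℝ (Fin d) × EuclideanSpace ℝ (Fin d)))).IsAddHaarMeasure

instance : SigmaFinite (volume : Measure (Config d s)) :=
  inferInstanceAs (SigmaFinite (Measure.pi fun _ : Fin s => (volume :
    Measure (EuclideanSpace ℝ (Fin d) × EuclideanSpace ℝ (Fin d)))))

/-- A quarter of the discriminant of the quadratic equation for the times at which the free
trajectories of `i` and `j` are at distance `ε`. -/
noncomputable def contactDisc (ε : ℝ) (i j : Fin s) (Z : Config d s) : ℝ :=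
  inner ℝ ((Z j).1 - (Z i).1) ((Z j).2 - (Z i).2) ^ 2
    - ‖(Z j).2 - (Z i).2‖ ^ 2 * (‖(Z j).1 - (Z i).1‖ ^ 2 - ε ^ 2)

/-- The two times (for `c = -1` and `c = 1`) at which the free trajectories of `i` and `j` are at
distance `ε`. -/
noncomputable def contactTime (ε c : ℝ) (i j : Fin s) (Z : Config d s) : ℝ :=
  (-inner ℝ ((Z j).1 - (Z i).1) ((Z j).2 - (Z i).2) + c * √(contactDisc ε i j Z))
    / ‖(Z j).2 - (Z i).2‖ ^ 2

theorem freeFlow_relPos (τ : ℝ) (i j : Fin s) (Z : Config d s) :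
    (freeFlow τ Z j).1 - (freeFlow τ Z i).1
      = ((Z j).1 - (Z i).1) + τ • ((Z j).2 - (Z i).2) := by
  simp only [freeFlow, smul_sub]
  abel

/-- The discriminant is constant along the free flow. At contact its second term vanishes, so a
nonzero value there excludes grazing. -/
theorem contactDisc_eq {ε τ : ℝ} {i j : Fin s} {Z : Config d s}
    (hZ : ‖(freeFlow τ Z j).1 - (freeFlow τ Z i).1‖ = ε) :
    contactDisc ε i j Z
      = inner ℝ ((freeFlow τ Z j).1 - (freeFlow τ Z i).1) ((Z j).2 - (Z i).2) ^ 2 := by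
  rw [← hZ, contactDisc, freeFlow_relPos]
  set x := (Z j).1 - (Z i).1
  set v := (Z j).2 - (Z i).2
  rw [norm_add_sq_real, inner_add_left, inner_smul_left, inner_smul_right, norm_smul, mul_pow,
    Real.norm_eq_abs, sq_abs, real_inner_self_eq_norm_sq]
  simp only [conj_trivial]
  ring

/-- The sign of the radial velocity at contact selects the root: approaching gives the earlier one,
separating the later one. -/
theorem eq_contactTime {ε τ c : ℝ} {i j : Fin s} {Z : Config d s}
    (hZ : ‖(freeFlow τ Z j).1 - (freeFlow τ Z i).1‖ = ε) (hv : (Z j).2 - (Z i).2 ≠ 0)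
    (hc : c * |inner ℝ ((freeFlow τ Z j).1 - (freeFlow τ Z i).1) ((Z j).2 - (Z i).2)|
      = inner ℝ ((freeFlow τ Z j).1 - (freeFlow τ Z i).1) ((Z j).2 - (Z i).2)) :
    τ = contactTime ε c i j Z := by
  have hv2 : ‖(Z j).2 - (Z i).2‖ ^ 2 ≠ 0 := pow_ne_zero 2 (norm_ne_zero_iff.2 hv)
  rw [contactTime, contactDisc_eq hZ, Real.sqrt_sq_eq_abs, hc, freeFlow_relPos, inner_add_left,
    inner_smul_left, real_inner_self_eq_norm_sq, eq_div_iff hv2]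
  simp

theorem relVel_ne_zero {ε : ℝ} {i j : Fin s} {Z : Config d s} (h : contactDisc ε i j Z ≠ 0) :
    (Z j).2 - (Z i).2 ≠ 0 := by
  intro hv
  simp [contactDisc, hv] at h

theorem differentiable_contactDisc (ε : ℝ) (i j : Fin s) :
    Differentiable ℝ (contactDisc ε i j : Config d s → ℝ) := by
  unfold contactDisc
  have h1 : ∀ k : Fin s, Differentiable ℝ fun Z : Config d s => (Z k).1 := fun k => by fun_prop
  have h2 : ∀ k : Fin s, Differentiable ℝ fun Z : Config d s => (Z k).2 := fun k => by fun_prop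
  refine (((((h1 j).sub (h1 i)).inner ℝ ((h2 j).sub (h2 i))).pow 2).sub ?_)
  exact (((h2 j).sub (h2 i)).norm_sq ℝ).mul ((((h1 j).sub (h1 i)).norm_sq ℝ).sub_const _)

theorem differentiableAt_contactTime {ε : ℝ} (c : ℝ) {i j : Fin s} {Z : Config d s}
    (h : contactDisc ε i j Z ≠ 0) : DifferentiableAt ℝ (contactTime ε c i j) Z := by
  have h1 : ∀ k : Fin s, Differentiable ℝ fun Z : Config d s => (Z k).1 := fun k => by fun_prop
  have h2 : ∀ k : Fin s, Differentiable ℝ fun Z : Config d s => (Z k).2 := fun k => by fun_prop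
  unfold contactTime
  have hv : Differentiable ℝ fun Z : Config d s => ‖(Z j).2 - (Z i).2‖ ^ 2 :=
    ((h2 j).sub (h2 i)).norm_sq ℝ
  simp only [div_eq_mul_inv]
  refine DifferentiableAt.fun_mul ?_
    ((hv Z).fun_inv (pow_ne_zero 2 (norm_ne_zero_iff.2 (relVel_ne_zero h))))
  refine DifferentiableAt.fun_add
    (((h1 j).sub (h1 i)).inner ℝ ((h2 j).sub (h2 i)) Z).fun_neg ?_
  exact ((differentiable_contactDisc ε i j Z).sqrt h).const_mul c

theorem differentiableAt_freeFlow {τ : Config d s → ℝ} {F : Config d s → Config d s}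
    {Z : Config d s} (hτ : DifferentiableAt ℝ τ Z) (hF : DifferentiableAt ℝ F Z) :
    DifferentiableAt ℝ (fun W => freeFlow (τ W) (F W)) Z := by
  refine differentiableAt_pi.2 fun k => ?_
  have hk := differentiableAt_pi.1 hF k
  exact (hk.fst.add (hτ.smul hk.snd)).prodMk hk.snd

theorem differentiable_collide (ε : ℝ) (i j : Fin s) :
    Differentiable ℝ (collide ε i j : Config d s → Config d s) := by
  have h1 : ∀ k : Fin s, Differentiable ℝ fun Z : Config d s => (Z k).1 := fun k => by fun_prop
  have h2 : ∀ k : Fin s, Differentiable ℝ fun Z : Config d s => (Z k).2 := fun k => by fun_prop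
  have hω : Differentiable ℝ fun Z : Config d s => ε⁻¹ • ((Z j).1 - (Z i).1) :=
    ((h1 j).sub (h1 i)).const_smul ε⁻¹
  have hp : Differentiable ℝ fun Z : Config d s => impulse ε i j Z :=
    (hω.inner ℝ ((h2 j).sub (h2 i))).smul hω
  refine differentiable_pi.2 fun k => ?_
  by_cases hi : k = i
  · have : (fun Z : Config d s => collide ε i j Z k)
        = fun Z => ((Z i).1, (Z i).2 + impulse ε i j Z) := by
      funext Z; simp [collide, impulse, hi]
    rw [this]
    exact (h1 i).prodMk ((h2 i).add hp)
  by_cases hj : k = j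
  · have : (fun Z : Config d s => collide ε i j Z k)
        = fun Z => ((Z j).1, (Z j).2 - impulse ε i j Z) := by
      funext Z; simp only [collide, impulse, if_neg hi, if_pos hj]
    rw [this]
    exact (h1 j).prodMk ((h2 j).sub hp)
  · have : (fun Z : Config d s => collide ε i j Z k) = fun Z => Z k := by
      funext Z; exact collide_of_ne hi hj Z
    rw [this]
    fun_prop

/-! ### Null sets under collisions, free flow and particle removal -/

/-- The trajectories that run into a null set by a collision of `i` and `j` form a null set. -/
theorem volume_incoming_recoil_mem_eq_zero {ε : ℝ} (hε : 0 < ε) (i j : Fin s)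
    {N : Set (Config d s)} (hN : volume N = 0) :
    volume {Z : Config d s | ∃ τ, IsIncoming ε i j (freeFlow τ Z) ∧ recoil ε i j τ Z ∈ N} = 0 := by
  -- `recoil` at a fixed time of contact is an involution, so `Z` is recovered from its outgoing
  -- trajectory, for which the collision is the later contact. This recovery map is differentiable
  -- off grazing and therefore maps null sets to null sets.
  have hD : DifferentiableOn ℝ (fun W : Config d s => recoil ε i j (contactTime ε 1 i j W) W)
      (N ∩ {W | contactDisc ε i j W ≠ 0}) := by
    rintro W ⟨-, hW⟩
    have hτ := differentiableAt_contactTime 1 hW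
    refine DifferentiableAt.differentiableWithinAt ?_
    exact differentiableAt_freeFlow hτ.neg
      ((differentiable_collide ε i j _).comp W (differentiableAt_freeFlow hτ differentiableAt_id))
  refine measure_mono_null ?_ (addHaar_image_eq_zero_of_differentiableOn_of_addHaar_eq_zero volume
    hD (measure_mono_null Set.inter_subset_left hN))
  rintro Z ⟨τ, hin, hZN⟩
  obtain ⟨hij, hc, hneg⟩ := hin
  have hout : 0 < inner ℝ ((freeFlow τ (recoil ε i j τ Z) j).1
        - (freeFlow τ (recoil ε i j τ Z) i).1)
      ((recoil ε i j τ Z j).2 - (recoil ε i j τ Z i).2) := by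
    rw [← freeFlow_snd τ (recoil ε i j τ Z), ← freeFlow_snd τ (recoil ε i j τ Z),
      freeFlow_recoil, collide_fst, collide_fst, inner_collide_relVel hε hij hc]
    exact neg_pos.2 hneg
  have hc' : ‖(freeFlow τ (recoil ε i j τ Z) j).1 - (freeFlow τ (recoil ε i j τ Z) i).1‖ = ε := by
    rw [freeFlow_recoil, collide_fst, collide_fst, hc]
  have hdisc : contactDisc ε i j (recoil ε i j τ Z) ≠ 0 := by
    rw [contactDisc_eq hc']
    exact (pow_pos hout 2).ne'
  refine ⟨recoil ε i j τ Z, ⟨hZN, hdisc⟩, ?_⟩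
  have hτ := eq_contactTime (c := 1) hc' (relVel_ne_zero hdisc) (by rw [abs_of_pos hout, one_mul])
  simp only
  rw [← hτ, recoil_recoil hε hij hc]

/-- Every null set is contained in a null set that cannot be reached by collisions from its
complement. -/
theorem exists_null_superset_closed_under_collisions {ε : ℝ} (hε : 0 < ε) {N : Set (Config d s)}
    (hN : volume N = 0) : ∃ M : Set (Config d s), volume M = 0 ∧ N ⊆ M ∧
      ∀ i j τ Z, IsIncoming ε i j (freeFlow τ Z) → recoil ε i j τ Z ∈ M → Z ∈ M := by
  let P : Set (Config d s) → Set (Config d s) := fun A =>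
    ⋃ i, ⋃ j, {Z | ∃ τ, IsIncoming ε i j (freeFlow τ Z) ∧ recoil ε i j τ Z ∈ A}
  refine ⟨⋃ n, P^[n] N, ?_, Set.subset_iUnion (fun n => P^[n] N) 0, ?_⟩
  · refine measure_iUnion_null fun n => ?_
    induction n with
    | zero => exact hN
    | succ n ih =>
      rw [Function.iterate_succ_apply']
      exact measure_iUnion_null fun i => measure_iUnion_null fun j =>
        volume_incoming_recoil_mem_eq_zero hε i j ih
  · intro i j τ Z hin hM
    obtain ⟨n, hn⟩ := Set.mem_iUnion.1 hM
    refine Set.mem_iUnion.2 ⟨n + 1, ?_⟩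
    rw [Function.iterate_succ_apply']
    exact Set.mem_iUnion.2 ⟨i, Set.mem_iUnion.2 ⟨j, τ, hin, hn⟩⟩

theorem volume_freeFlow_preimage_eq_zero (a : ℝ) {N : Set (Config d s)} (hN : volume N = 0) :
    volume (freeFlow a ⁻¹' N) = 0 := by
  have hD : DifferentiableOn ℝ (freeFlow (-a) : Config d s → Config d s) N := fun W _ =>
    (differentiableAt_freeFlow (differentiableAt_const (-a))
      differentiableAt_id).differentiableWithinAt
  refine measure_mono_null ?_
    (addHaar_image_eq_zero_of_differentiableOn_of_addHaar_eq_zero volume hD hN)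
  intro Z hZ
  exact ⟨freeFlow a Z, hZ, by rw [freeFlow_freeFlow, neg_add_cancel, freeFlow_zero]⟩

theorem volume_removeParticle_preimage_eq_zero (i : Fin (s + 1)) {N : Set (Config d s)}
    (hN : volume N = 0) : volume (removeParticle i ⁻¹' N) = 0 := by
  have h1 := (Measure.quasiMeasurePreserving_snd
    (μ := (volume : Measure (EuclideanSpace ℝ (Fin d) × EuclideanSpace ℝ (Fin d))))
    (ν := (volume : Measure (Config d s)))).comp
    (volume_preserving_piFinSuccAbove
      (fun _ : Fin (s + 1) => EuclideanSpace ℝ (Fin d) × EuclideanSpace ℝ (Fin d))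
      i).quasiMeasurePreserving
  exact h1.preimage_null hN

/-- Fubini: a measurable set of configurations is null if almost all of its sections in the position
of one particle are null. -/
theorem volume_eq_zero_of_sections {A : Set (Config d (s + 1))} (hA : MeasurableSet A)
    (k : Fin (s + 1))
    (h : ∀ Z, ∀ᵐ v, volume {x : EuclideanSpace ℝ (Fin d) | Function.update Z k (x, v) ∈ A} = 0) :
    volume A = 0 := by
  have hp := volume_preserving_piFinSuccAbove
      (fun _ : Fin (s + 1) => EuclideanSpace ℝ (Fin d) × EuclideanSpace ℝ (Fin d)) k
  set e := MeasurableEquiv.piFinSuccAbove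
      (fun _ : Fin (s + 1) => EuclideanSpace ℝ (Fin d) × EuclideanSpace ℝ (Fin d)) k with he
  rw [← hp.symm.measure_preimage hA.nullMeasurableSet, Measure.volume_eq_prod,
    Measure.prod_apply_symm (e.symm.measurable hA)]
  refine lintegral_eq_zero_of_ae_eq_zero (Eventually.of_forall fun W => ?_)
  have hm : MeasurableSet ((fun z => (z, W)) ⁻¹' (e.symm ⁻¹' A)) :=
    measurable_prodMk_right (e.symm.measurable hA)
  simp only [Pi.zero_apply]
  rw [Measure.volume_eq_prod, Measure.prod_apply_symm hm]
  refine lintegral_eq_zero_of_ae_eq_zero ?_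
  -- The entry `0` is a dummy that the update overwrites.
  filter_upwards [h (k.insertNth 0 W)] with v hv
  simp only [Fin.update_insertNth] at hv
  exact hv

/-! ### Almost every free trajectory is generic -/

theorem volume_norm_add_eq_zero [NeZero d] (a : EuclideanSpace ℝ (Fin d)) (r : ℝ) :
    volume {x : EuclideanSpace ℝ (Fin d) | ‖x + a‖ = r} = 0 := by
  have : {x : EuclideanSpace ℝ (Fin d) | ‖x + a‖ = r} = Metric.sphere (-a) r := by
    ext x
    simp
  rw [this]
  exact Measure.addHaar_sphere volume _ _

theorem measurable_fst_apply (k : Fin s) : Measurable fun Z : Config d s => (Z k).1 :=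
  (measurable_pi_apply k).fst

theorem measurable_snd_apply (k : Fin s) : Measurable fun Z : Config d s => (Z k).2 :=
  (measurable_pi_apply k).snd

/-- Contact of a particle `k` with another particle, at a time that does not depend on the position
of `k`, has measure zero. -/
theorem volume_contact_eq_zero [NeZero d] {ε : ℝ} {k l : Fin (s + 1)} (hkl : k ≠ l)
    {τ : Config d (s + 1) → ℝ} (hτ : Measurable τ)
    (hk : ∀ Z v x y, τ (Function.update Z k (x, v)) = τ (Function.update Z k (y, v))) :
    volume {Z : Config d (s + 1) |
      ‖(freeFlow (τ Z) Z k).1 - (freeFlow (τ Z) Z l).1‖ = ε} = 0 := by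
  refine volume_eq_zero_of_sections ?_ k fun Z => Eventually.of_forall fun v => ?_
  · refine measurableSet_eq_fun (Measurable.norm ?_) measurable_const
    have h1 := measurable_fst_apply (d := d) k
    have h2 := measurable_fst_apply (d := d) l
    have h3 := measurable_snd_apply (d := d) k
    have h4 := measurable_snd_apply (d := d) l
    exact (h1.add (hτ.smul h3)).sub (h2.add (hτ.smul h4))
  · set t := τ (Function.update Z k (0, v)) with ht
    refine measure_mono_null ?_ (volume_norm_add_eq_zero (t • v - ((Z l).1 + t • (Z l).2)) ε)
    intro x hx
    simp only [Set.mem_ofPred_eq, freeFlow, hk Z v x 0, Function.update_self,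
      Function.update_of_ne hkl.symm, ← ht] at hx ⊢
    rw [← hx]
    congr 1
    abel

/-- The level set lies in the frontier of the convex set `‖L (x + a)‖ ≤ r`, which is null: dilating
about `-a` by a factor above `1` leaves that set because `r > 0`. -/
theorem volume_norm_map_eq_zero {E F : Type*} [NormedAddCommGroup E] [NormedSpace ℝ E]
    [FiniteDimensional ℝ E] [MeasureSpace E] [BorelSpace E]
    [(volume : Measure E).IsAddHaarMeasure] [NormedAddCommGroup F] [NormedSpace ℝ F]
    (L : E →ₗ[ℝ] F) (a : E) {r : ℝ} (hr : 0 < r) : volume {x : E | ‖L (x + a)‖ = r} = 0 := by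
  have hconv : Convex ℝ {x : E | ‖L (x + a)‖ ≤ r} := by
    intro x hx y hy p q hp hq hpq
    simp only [Set.mem_ofPred_eq] at hx hy ⊢
    have h1 : p • x + q • y + a = p • (x + a) + q • (y + a) := by
      rw [smul_add, smul_add, add_add_add_comm, ← add_smul, hpq, one_smul]
    rw [h1, map_add, map_smul, map_smul]
    refine (norm_add_le _ _).trans ?_
    rw [norm_smul, norm_smul, Real.norm_of_nonneg hp, Real.norm_of_nonneg hq]
    nlinarith
  refine measure_mono_null ?_ (hconv.addHaar_frontier volume)
  intro x hx
  simp only [Set.mem_ofPred_eq] at hx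
  refine ⟨subset_closure hx.le, fun hint => ?_⟩
  have hcont : Tendsto (fun c : ℝ => c • (x + a) - a) (𝓝 1) (𝓝 x) := by
    have : Continuous fun c : ℝ => c • (x + a) - a := by fun_prop
    simpa using this.tendsto 1
  have hev := (hcont.eventually (mem_interior_iff_mem_nhds.1 hint))
  obtain ⟨c, hc, hc1⟩ := ((hev.filter_mono nhdsWithin_le_nhds).and
    (self_mem_nhdsWithin (s := Set.Ioi (1 : ℝ)) (a := 1))).exists
  simp only [sub_add_cancel, map_smul, norm_smul, hx] at hc
  rw [Real.norm_of_nonneg (zero_le_one.trans (le_of_lt hc1))] at hc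
  have hc1 : 1 < c := hc1
  nlinarith

/-- Grazing contact has measure zero. -/
theorem volume_contactDisc_eq_zero [NeZero d] {ε : ℝ} (hε : 0 < ε) {i j : Fin (s + 1)}
    (hij : i ≠ j) : volume {Z : Config d (s + 1) | contactDisc ε i j Z = 0} = 0 := by
  refine volume_eq_zero_of_sections
    (measurableSet_eq_fun (differentiable_contactDisc ε i j).continuous.measurable
      measurable_const) j fun Z => ?_
  have hae : ∀ᵐ v : EuclideanSpace ℝ (Fin d), v ≠ (Z i).2 := by
    simp [ae_iff]
  filter_upwards [hae] with v hv
  set w := v - (Z i).2 with hw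
  have hw0 : w ≠ 0 := sub_ne_zero.2 hv
  have hwp : 0 < ‖w‖ := norm_pos_iff.2 hw0
  -- `L` is `‖w‖ ^ 2` times the projection orthogonal to `w`. Zero discriminant means that the line
  -- of relative motion is tangent to the `ε`-sphere, so the relative position lies on a cylinder
  -- with axis `w`.
  let L : EuclideanSpace ℝ (Fin d) →ₗ[ℝ] EuclideanSpace ℝ (Fin d) :=
    ‖w‖ ^ 2 • LinearMap.id - (innerₛₗ ℝ w).smulRight w
  have hL : ∀ x, L x = ‖w‖ ^ 2 • x - inner ℝ w x • w := fun x => by simp [L]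
  refine measure_mono_null ?_
    (volume_norm_map_eq_zero L (-(Z i).1) (r := ‖w‖ ^ 2 * ε) (by positivity))
  intro x hx
  simp only [Set.mem_ofPred_eq, contactDisc, Function.update_self, Function.update_of_ne hij,
    ← hw] at hx ⊢
  rw [← sub_eq_add_neg, hL]
  set y := x - (Z i).1
  rw [← sq_eq_sq₀ (norm_nonneg _) (by positivity), norm_sub_sq_real, norm_smul, norm_smul,
    inner_smul_left, inner_smul_right, mul_pow, mul_pow, Real.norm_eq_abs, Real.norm_eq_abs,
    sq_abs, sq_abs, real_inner_comm w y]
  simp only [conj_trivial]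
  rw [real_inner_comm] at hx
  linear_combination (-‖w‖ ^ 2) * hx

/-- The free trajectory of `Z` has no grazing contact, no simultaneous contacts of two pairs, and no
contact at time `t`. -/
structure IsGeneric (ε t : ℝ) (Z : Config d s) : Prop where
  disc_ne : ∀ i j, i ≠ j → contactDisc ε i j Z ≠ 0
  single : ∀ i j k l, i ≠ j → k ≠ l → ¬ (k = i ∧ l = j) → ¬ (k = j ∧ l = i) → ∀ τ,
    ‖(freeFlow τ Z j).1 - (freeFlow τ Z i).1‖ = ε → ‖(freeFlow τ Z l).1 - (freeFlow τ Z k).1‖ ≠ ε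
  final : ∀ i j, i ≠ j → ‖(freeFlow t Z j).1 - (freeFlow t Z i).1‖ ≠ ε

theorem contactTime_update (ε c : ℝ) {i j k : Fin s} (hi : k ≠ i) (hj : k ≠ j) (Z : Config d s)
    (z : EuclideanSpace ℝ (Fin d) × EuclideanSpace ℝ (Fin d)) :
    contactTime ε c i j (Function.update Z k z) = contactTime ε c i j Z := by
  simp [contactTime, contactDisc, hi.symm, hj.symm]

theorem measurable_contactTime (ε c : ℝ) (i j : Fin s) :
    Measurable (contactTime ε c i j : Config d s → ℝ) := by
  have h0 := (differentiable_contactDisc (d := d) ε i j).continuous.measurable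
  have h1 := measurable_fst_apply (d := d) i
  have h2 := measurable_fst_apply (d := d) j
  have h3 := measurable_snd_apply (d := d) i
  have h4 := measurable_snd_apply (d := d) j
  unfold contactTime
  exact (((h2.sub h1).inner (h4.sub h3)).neg.add (measurable_const.mul h0.sqrt)).div
    ((h4.sub h3).norm.pow_const 2)

/-- For a simultaneous contact, the contact time of one pair is a root depending on that pair alone.
A particle of the other pair outside it must then lie on a sphere once all other coordinates are
fixed. -/
theorem ae_isGeneric [NeZero d] {ε : ℝ} (hε : 0 < ε) (t : ℝ) :
    ∀ᵐ Z : Config d (s + 1), IsGeneric ε t Z := by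
  have h1 : ∀ᵐ Z : Config d (s + 1), ∀ i j, i ≠ j → contactDisc ε i j Z ≠ 0 := by
    refine ae_all_iff.2 fun i => ae_all_iff.2 fun j => ?_
    by_cases hij : i = j
    · exact Eventually.of_forall fun _ h => absurd hij h
    · filter_upwards [measure_eq_zero_iff_ae_notMem.1 (volume_contactDisc_eq_zero (d := d) hε hij)]
        with Z hZ _ using hZ
  have h2 : ∀ᵐ Z : Config d (s + 1), ∀ i j, i ≠ j →
      ‖(freeFlow t Z j).1 - (freeFlow t Z i).1‖ ≠ ε := by
    refine ae_all_iff.2 fun i => ae_all_iff.2 fun j => ?_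
    by_cases hij : i = j
    · exact Eventually.of_forall fun _ h => absurd hij h
    · filter_upwards [measure_eq_zero_iff_ae_notMem.1 (volume_contact_eq_zero (d := d) (ε := ε)
        (Ne.symm hij) (measurable_const (a := t)) fun _ _ _ _ => rfl)] with Z hZ _ using hZ
  have h3 : ∀ᵐ Z : Config d (s + 1), ∀ b : Bool, ∀ i j k l, k ≠ l → k ≠ i → k ≠ j →
      ‖(freeFlow (contactTime ε (cond b 1 (-1)) i j Z) Z k).1
        - (freeFlow (contactTime ε (cond b 1 (-1)) i j Z) Z l).1‖ ≠ ε := by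
    refine ae_all_iff.2 fun b => ae_all_iff.2 fun i => ae_all_iff.2 fun j => ae_all_iff.2 fun k =>
      ae_all_iff.2 fun l => ?_
    by_cases h : k ≠ l ∧ k ≠ i ∧ k ≠ j
    · filter_upwards [measure_eq_zero_iff_ae_notMem.1 (volume_contact_eq_zero (d := d) (ε := ε)
        h.1 (measurable_contactTime ε (cond b 1 (-1)) i j) fun Z v x y => by
          rw [contactTime_update _ _ h.2.1 h.2.2, contactTime_update _ _ h.2.1 h.2.2])]
        with Z hZ _ _ _ using hZ
    · exact Eventually.of_forall fun _ ha hb hc => absurd ⟨ha, hb, hc⟩ h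
  filter_upwards [h1, h2, h3] with Z hZ1 hZ2 hZ3
  refine ⟨hZ1, fun i j k l hij hkl hn1 hn2 τ hτ => ?_, hZ2⟩
  have hcon : ∃ b : Bool, τ = contactTime ε (cond b 1 (-1)) i j Z := by
    have hv := relVel_ne_zero (hZ1 i j hij)
    rcases le_total 0 (inner ℝ ((freeFlow τ Z j).1 - (freeFlow τ Z i).1) ((Z j).2 - (Z i).2))
      with h | h
    · exact ⟨true, eq_contactTime hτ hv (by simp [abs_of_nonneg h])⟩
    · exact ⟨false, eq_contactTime hτ hv (by simp [abs_of_nonpos h])⟩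
  obtain ⟨b, hb⟩ := hcon
  have h4 := hZ3 b i j
  rw [← hb] at h4
  by_cases hk : k ≠ i ∧ k ≠ j
  · rw [norm_sub_rev]
    exact h4 k l hkl hk.1 hk.2
  -- The two pairs differ, so if `k` belongs to the first one, `l` does not, and their roles are
  -- exchanged.
  · refine h4 l k hkl.symm ?_ ?_ <;> grind

/-! ### The first collision along a free trajectory -/

theorem continuous_freeFlow (Z : Config d s) : Continuous fun σ : ℝ => freeFlow σ Z := by
  refine continuous_pi fun k => ?_
  simp only [freeFlow]
  fun_prop

theorem isOpen_phaseSpace (ε : ℝ) : IsOpen (phaseSpace d s ε) := by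
  have h1 : ∀ k : Fin s, Continuous fun Z : Config d s => (Z k).1 := fun k =>
    (continuous_apply k).fst
  have h2 : phaseSpace d s ε = ⋂ i : Fin s, ⋂ j : Fin s, {Z | i < j → ε < ‖(Z i).1 - (Z j).1‖} := by
    ext Z
    simp [phaseSpace]
  rw [h2]
  refine isOpen_iInter_of_finite fun i => isOpen_iInter_of_finite fun j => ?_
  by_cases hij : i < j
  · simp only [hij, true_imp_iff]
    exact isOpen_lt continuous_const ((h1 i).sub (h1 j)).norm
  · simp only [hij, false_imp_iff]
    exact isOpen_univ

/-- The free trajectory of `Z` stays in the phase space between the times `a` and `b`. -/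
def IsFreeOn (ε a b : ℝ) (Z : Config d s) : Prop :=
  ∀ σ, a < σ → σ < b → freeFlow σ Z ∈ phaseSpace d s ε

theorem IsFreeOn.remove {ε a b : ℝ} {Z : Config d (s + 1)} (h : IsFreeOn ε a b Z)
    (i : Fin (s + 1)) : IsFreeOn ε a b (removeParticle i Z) := by
  intro σ h1 h2
  rw [← removeParticle_freeFlow]
  exact removeParticle_mem_phaseSpace i (h σ h1 h2)

theorem norm_freeFlow_sq (u : ℝ) (i j : Fin s) (Z : Config d s) :
    ‖(freeFlow u Z j).1 - (freeFlow u Z i).1‖ ^ 2 = ‖(Z j).1 - (Z i).1‖ ^ 2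
      + 2 * u * inner ℝ ((Z j).1 - (Z i).1) ((Z j).2 - (Z i).2)
      + u ^ 2 * ‖(Z j).2 - (Z i).2‖ ^ 2 := by
  rw [freeFlow_relPos, norm_add_sq_real, inner_smul_right, norm_smul, mul_pow, Real.norm_eq_abs,
    sq_abs]
  ring

/-- Before `τ` the distance exceeds `ε`, so its square cannot be increasing at contact; the nonzero
discriminant rules out vanishing derivative. -/
theorem isIncoming_of_isFreeOn {ε a τ : ℝ} {i j : Fin s} {W : Config d s} (ha : a < τ)
    (hW : IsFreeOn ε a τ W) (hε : 0 < ε) (hij : i ≠ j) (hdisc : contactDisc ε i j W ≠ 0)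
    (hc : ‖(freeFlow τ W j).1 - (freeFlow τ W i).1‖ = ε) :
    IsIncoming ε i j (freeFlow τ W) := by
  refine ⟨hij, hc, ?_⟩
  set Y := freeFlow τ W with hY
  set c := inner ℝ ((Y j).1 - (Y i).1) ((Y j).2 - (Y i).2) with hcdef
  have hc0 : c ≠ 0 := by
    intro h
    refine hdisc ?_
    rw [contactDisc_eq hc, ← hY]
    change c ^ 2 = 0
    rw [h, zero_pow two_ne_zero]
  refine lt_of_le_of_ne ?_ hc0
  have hlim : Tendsto (fun σ => (τ - σ) * ‖(Y j).2 - (Y i).2‖ ^ 2) (𝓝[<] τ) (𝓝 0) := by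
    have : Continuous fun σ => (τ - σ) * ‖(Y j).2 - (Y i).2‖ ^ 2 := by fun_prop
    have h2 := this.tendsto τ
    rw [sub_self, zero_mul] at h2
    exact h2.mono_left nhdsWithin_le_nhds
  have h2c : 2 * c ≤ 0 := by
    refine ge_of_tendsto hlim ?_
    filter_upwards [Ioo_mem_nhdsLT ha] with σ hσ
    have h1 := mem_phaseSpace_iff.1 (hW σ hσ.1 hσ.2) i j hij
    have h2 : freeFlow σ W = freeFlow (σ - τ) Y := by rw [hY, freeFlow_freeFlow, sub_add_cancel]
    have h3 := norm_freeFlow_sq (σ - τ) i j Y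
    rw [← h2, hc] at h3
    have h4 : ε ^ 2 < ‖(freeFlow σ W j).1 - (freeFlow σ W i).1‖ ^ 2 :=
      pow_lt_pow_left₀ h1 hε.le two_ne_zero
    rw [h3, ← hcdef] at h4
    have h5 : 0 < τ - σ := sub_pos.2 hσ.2
    have h6 : 0 < (τ - σ) * ((τ - σ) * ‖(Y j).2 - (Y i).2‖ ^ 2 - 2 * c) := by nlinarith
    have := (pos_iff_pos_of_mul_pos h6).1 h5
    linarith
  linarith

theorem collide_mem_postContactSet {ε : ℝ} (hε : 0 < ε) {i j : Fin s} {Y : Config d s}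
    (hY : Y ∈ contactSet d s ε i j) (hin : IsIncoming ε i j Y) :
    collide ε i j Y ∈ postContactSet d s ε i j := by
  refine ⟨⟨hY.1, by simpa using hY.2.1, fun k l h1 h2 h3 => by simpa using hY.2.2 k l h1 h2 h3⟩, ?_⟩
  rw [collide_fst, collide_fst, inner_collide_relVel hε hin.1 hin.2.1]
  exact neg_pos.2 hin.2.2

/-- The separating pair has squared distance `ε ^ 2` plus positive terms for all later times; every
other pair stays apart briefly by continuity. -/
theorem exists_isFreeOn_of_mem_postContactSet {ε : ℝ} {i j : Fin s} {Y : Config d s}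
    (hY : Y ∈ postContactSet d s ε i j) : ∃ δ > 0, IsFreeOn ε 0 δ Y := by
  obtain ⟨⟨hij, hc, hsep⟩, hout⟩ := hY
  have hpair : ∀ u : ℝ, 0 < u → ε < ‖(freeFlow u Y j).1 - (freeFlow u Y i).1‖ := by
    intro u hu
    refine lt_of_pow_lt_pow_left₀ 2 (norm_nonneg _) ?_
    rw [norm_freeFlow_sq, norm_sub_rev (Y j).1, hc]
    have := mul_pos hu hout
    nlinarith [mul_nonneg (sq_nonneg u) (sq_nonneg ‖(Y j).2 - (Y i).2‖)]
  have hev : ∀ᶠ u in 𝓝[>] (0 : ℝ), freeFlow u Y ∈ phaseSpace d s ε := by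
    simp only [mem_phaseSpace_iff]
    refine eventually_all.2 fun k => eventually_all.2 fun l => ?_
    by_cases h1 : k = i ∧ l = j
    · filter_upwards [self_mem_nhdsWithin] with u hu _
      rw [h1.1, h1.2]
      exact hpair u hu
    by_cases h2 : k = j ∧ l = i
    · filter_upwards [self_mem_nhdsWithin] with u hu _
      rw [h2.1, h2.2, norm_sub_rev]
      exact hpair u hu
    by_cases hkl : k = l
    · exact Eventually.of_forall fun _ h => absurd hkl h
    have hcont : Continuous fun u : ℝ => ‖(freeFlow u Y l).1 - (freeFlow u Y k).1‖ := by
      have h3 := continuous_freeFlow Y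
      fun_prop
    have h4 : ε < ‖(freeFlow 0 Y l).1 - (freeFlow 0 Y k).1‖ := by
      rw [freeFlow_zero, norm_sub_rev]
      exact hsep k l hkl h1 h2
    filter_upwards [nhdsWithin_le_nhds (hcont.continuousAt.eventually_const_lt h4)] with u hu _
      using hu
  obtain ⟨δ, hδ, hsub⟩ := (mem_nhdsGT_iff_exists_Ioo_subset).1 hev
  exact ⟨δ, hδ, fun σ h1 h2 => hsub ⟨h1, h2⟩⟩

/-- A generic free trajectory either is collisionless until `t`, or its first contact before `t` is a
binary collision, after which the trajectory is free for some time. -/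
theorem isFreeOn_or_exists_collision {ε T t δ : ℝ} (hε : 0 < ε) {W : Config d s}
    (hW : IsGeneric ε t W) (hT : T < t) (hδ : 0 < δ) (hfree : IsFreeOn ε T (T + δ) W) :
    (IsFreeOn ε T t W ∧ freeFlow t W ∈ phaseSpace d s ε) ∨
      ∃ τ i j, T < τ ∧ τ < t ∧ IsFreeOn ε T τ W ∧ freeFlow τ W ∈ contactSet d s ε i j ∧
        IsIncoming ε i j (freeFlow τ W) ∧
        ∃ δ' > 0, IsFreeOn ε τ (τ + δ') (recoil ε i j τ W) := by
  -- The segment may start in contact just after a collision, so the search for the first exit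
  -- begins at an interior time `a`, where freeness is already known.
  obtain ⟨a, ha1, ha2⟩ := exists_between (lt_min hT (lt_add_of_pos_right T hδ))
  obtain ⟨hat, haδ⟩ := lt_min_iff.1 ha2
  set A := Set.Icc a t ∩ {σ | freeFlow σ W ∉ phaseSpace d s ε} with hA
  rcases A.eq_empty_or_nonempty with hemp | hne
  · left
    have h1 : ∀ σ, T < σ → σ ≤ t → freeFlow σ W ∈ phaseSpace d s ε := by
      intro σ hσ1 hσ2
      by_contra hn
      rcases lt_or_ge σ a with h | h
      · exact hn (hfree σ hσ1 (h.trans haδ))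
      · have : σ ∈ A := ⟨⟨h, hσ2⟩, hn⟩
        rw [hemp] at this
        exact this
    exact ⟨fun σ h2 h3 => h1 σ h2 h3.le, h1 t hT le_rfl⟩
  right
  have hcomp : IsCompact A := isCompact_Icc.inter_right
    (((isOpen_phaseSpace ε).preimage (continuous_freeFlow W)).isClosed_compl)
  obtain ⟨τ, hτA, hτmin⟩ := hcomp.exists_isLeast hne
  have hTτ : T < τ := ha1.trans_le hτA.1.1
  have hτfree : IsFreeOn ε T τ W := by
    intro σ hσ1 hσ2
    by_contra hn
    rcases lt_or_ge σ a with h | h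
    · exact hn (hfree σ hσ1 (h.trans haδ))
    · exact absurd (hτmin ⟨⟨h, hσ2.le.trans hτA.1.2⟩, hn⟩) (not_le.2 hσ2)
  have hge : ∀ k l, k ≠ l → ε ≤ ‖(freeFlow τ W l).1 - (freeFlow τ W k).1‖ := by
    intro k l hkl
    have hcont : Continuous fun u : ℝ => ‖(freeFlow u W l).1 - (freeFlow u W k).1‖ := by
      have h3 := continuous_freeFlow W
      fun_prop
    refine ge_of_tendsto ((hcont.tendsto τ).mono_left (nhdsWithin_le_nhds (s := Set.Iio τ))) ?_
    filter_upwards [Ioo_mem_nhdsLT hTτ] with σ hσ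
    exact (mem_phaseSpace_iff.1 (hτfree σ hσ.1 hσ.2) k l hkl).le
  have hnot := hτA.2
  simp only [Set.mem_ofPred_eq, mem_phaseSpace_iff, not_forall, not_lt] at hnot
  obtain ⟨i, j, hij, hle⟩ := hnot
  have hc := le_antisymm hle (hge i j hij)
  have hin := isIncoming_of_isFreeOn hTτ hτfree hε hij (hW.disc_ne i j hij) hc
  have hmem : freeFlow τ W ∈ contactSet d s ε i j := by
    refine ⟨hij, by rw [norm_sub_rev]; exact hc, fun k l hkl h1 h2 => ?_⟩
    rw [norm_sub_rev]
    exact lt_of_le_of_ne (hge k l hkl) (hW.single i j k l hij hkl h1 h2 τ hc).symm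
  refine ⟨τ, i, j, hTτ, lt_of_le_of_ne hτA.1.2 ?_, hτfree, hmem, hin, ?_⟩
  · rintro rfl
    exact hW.final i j hij hc
  · obtain ⟨δ', hδ', h⟩ :=
      exists_isFreeOn_of_mem_postContactSet (collide_mem_postContactSet hε hmem hin)
    refine ⟨δ', hδ', fun σ h1 h2 => ?_⟩
    have h3 := h (σ - τ) (by linarith) (by linarith)
    rwa [← freeFlow_recoil, freeFlow_freeFlow, sub_add_cancel] at h3

/-! ### Comparison along free segments and through collisions -/

theorem SolvesTransport.eq_along {ε a b t σ ρ : ℝ} {φ : ℝ → Config d s → ℝ}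
    (hφ : SolvesTransport ε φ) {U : Config d s} (hU : IsFreeOn ε a b U) (ha : a ≤ σ) (hσ : σ ≤ ρ)
    (hb : ρ ≤ b) (ht : ρ ≤ t) : φ (t - σ) (freeFlow σ U) = φ (t - ρ) (freeFlow ρ U) := by
  have h := hφ (t - ρ) (ρ - σ) (sub_nonneg.2 ht) (sub_nonneg.2 hσ) (freeFlow σ U) fun u h1 h2 => by
    rw [freeFlow_freeFlow]
    exact hU _ (by linarith) (by linarith)
  rwa [freeFlow_freeFlow, sub_add_cancel, sub_add_sub_cancel] at h

/-- A comparison at all rational times carries over to the end points of a free trajectory. -/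
theorem abs_le_of_forall_rat {ε a b t σ : ℝ} {φ φhat : ℝ → Config d s → ℝ}
    (hφ : SolvesTransport ε φ) (hφhat : SolvesTransport ε φhat) {U : Config d s}
    (hU : IsFreeOn ε a b U) (ha : 0 ≤ a) (hab : a < b) (hb : b ≤ t) (hσ : σ = a ∨ σ = b)
    (h : ∀ r : ℚ, 0 ≤ (r : ℝ) → (r : ℝ) ≤ t → freeFlow r U ∈ phaseSpace d s ε →
      |φ (t - r) (freeFlow r U)| ≤ φhat (t - r) (freeFlow r U)) :
    |φ (t - σ) (freeFlow σ U)| ≤ φhat (t - σ) (freeFlow σ U) := by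
  obtain ⟨r, har, hrb⟩ := exists_rat_btwn hab
  have hr := h r (ha.trans har.le) (hrb.le.trans hb) (hU r har hrb)
  rcases hσ with rfl | rfl
  · rwa [hφ.eq_along hU le_rfl har.le hrb.le (hrb.le.trans hb),
      hφhat.eq_along hU le_rfl har.le hrb.le (hrb.le.trans hb)]
  · rwa [← hφ.eq_along hU har.le hrb.le le_rfl hb, ← hφhat.eq_along hU har.le hrb.le le_rfl hb]

/-- The comparison at the post-collisional point, together with the comparison of the lower order
terms, gives the comparison at the pre-collisional point. -/
theorem abs_le_of_jump {n x y xhat yhat a b a' b' ahat bhat ahat' bhat' : ℝ} (hn : 0 < n)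
    (h : y / n + a' + b' = x / n + a + b)
    (hhat : xhat / n - ahat - bhat = yhat / n + ahat' + bhat') (hy : |y| ≤ yhat)
    (ha : |a| ≤ ahat) (hb : |b| ≤ bhat) (ha' : |a'| ≤ ahat') (hb' : |b'| ≤ bhat') :
    |x| ≤ xhat := by
  have h1 : x = y + n * (a' + b' - a - b) := by
    field_simp at h
    linarith
  -- All four lower-order bounds appear with a plus sign, which dominates any signs in `h1`.
  have h2 : xhat = yhat + n * (ahat + bhat + ahat' + bhat') := by
    field_simp at hhat
    linarith
  rw [abs_le] at *
  rw [h1, h2]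
  constructor <;> nlinarith

/-- The comparison is transported backwards through a collision. -/
theorem comparison_of_recoil {N : ℕ} {ε : ℝ} {φ φhat : (s : ℕ) → ℝ → Config d s → ℝ} (hε : 0 < ε)
    (hφ : IsDualBBGKYSolution d N ε φ) (hφhat : IsModifiedSolution d N ε φhat) (hs : 1 ≤ s)
    (hsN : s + 1 ≤ N) {t T τ δ : ℝ} {i j : Fin (s + 1)} {W : Config d (s + 1)} (hT : 0 ≤ T)
    (hTτ : T < τ) (hτt : τ < t) (hδ : 0 < δ) (hfree : IsFreeOn ε T τ W)
    (hmem : freeFlow τ W ∈ contactSet d (s + 1) ε i j) (hin : IsIncoming ε i j (freeFlow τ W))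
    (hfree' : IsFreeOn ε τ (τ + δ) (recoil ε i j τ W))
    (hlow : ∀ W' ∈ ({W, recoil ε i j τ W} : Set _), ∀ r : ℚ, 0 ≤ (r : ℝ) → (r : ℝ) ≤ t → ∀ k,
      freeFlow r (removeParticle k W') ∈ phaseSpace d s ε →
      |φ s (t - r) (freeFlow r (removeParticle k W'))|
        ≤ φhat s (t - r) (freeFlow r (removeParticle k W')))
    (hpost : |φ (s + 1) (t - τ) (freeFlow τ (recoil ε i j τ W))|
      ≤ φhat (s + 1) (t - τ) (freeFlow τ (recoil ε i j τ W))) :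
    |φ (s + 1) (t - T) (freeFlow T W)| ≤ φhat (s + 1) (t - T) (freeFlow T W) := by
  have hs' : 1 ≤ s + 1 := Nat.le_add_left 1 s
  rw [(hφ.transport (s + 1) hs' hsN).eq_along hfree le_rfl hTτ.le le_rfl hτt.le,
    (hφhat.transport (s + 1) hs' hsN).eq_along hfree le_rfl hTτ.le le_rfl hτt.le]
  have htr := hφ.transport s hs (Nat.le_of_succ_le hsN)
  have htrhat := hφhat.transport s hs (Nat.le_of_succ_le hsN)
  have hpre : ∀ k, |φ s (t - τ) (removeParticle k (freeFlow τ W))|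
      ≤ φhat s (t - τ) (removeParticle k (freeFlow τ W)) := fun k =>
    abs_le_of_forall_rat htr htrhat (hfree.remove k) hT hTτ hτt.le (Or.inr rfl)
      fun r h1 h2 => hlow W (Or.inl rfl) r h1 h2 k
  have hpost' : ∀ k, |φ s (t - τ) (removeParticle k (collide ε i j (freeFlow τ W)))|
      ≤ φhat s (t - τ) (removeParticle k (collide ε i j (freeFlow τ W))) := by
    intro k
    -- Truncating at `t` keeps the time argument `t - r` nonnegative.
    have hlt : τ < min (τ + δ) t := lt_min (lt_add_of_pos_right τ hδ) hτt
    rw [← freeFlow_recoil]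
    exact abs_le_of_forall_rat htr htrhat (a := τ) (b := min (τ + δ) t)
      (fun σ h1 h2 => hfree'.remove k σ h1 (h2.trans_le (min_le_left _ _)))
      (hT.trans hTτ.le) hlt (min_le_right _ _) (Or.inl rfl)
      fun r h1 h2 => hlow _ (Or.inr rfl) r h1 h2 k
  have hn : (0 : ℝ) < (N : ℝ) - s := by
    have : ((s + 1 : ℕ) : ℝ) ≤ N := Nat.cast_le.2 hsN
    push_cast at this
    linarith
  have hj := hφ.jump s hs hsN (t - τ) (sub_pos.2 hτt) i j _ hmem
  have hjhat := hφhat.jump s hs hsN (t - τ) (sub_pos.2 hτt) i j _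
    (collide_mem_postContactSet hε hmem hin)
  -- The modified jump condition is taken at the outgoing point, whose collisional image is the
  -- incoming one.
  rw [collide_collide hε hin.1 hin.2.1] at hjhat
  rw [freeFlow_recoil] at hpost
  exact abs_le_of_jump hn hj hjhat hpost (hpre i) (hpre j) (hpost' i) (hpost' j)

/-- The comparison at the level `s + 1` along the trajectories that stay outside an exceptional
set. -/
theorem comparison_of_notMem {N : ℕ} {ε : ℝ} {φ φhat : (s : ℕ) → ℝ → Config d s → ℝ} (hε : 0 < ε)
    (hφ : IsDualBBGKYSolution d N ε φ) (hφhat : IsModifiedSolution d N ε φhat) (hsN : s + 1 ≤ N)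
    {t : ℝ} (ht : 0 < t) {M : Set (Config d (s + 1))}
    (hM : ∀ i j τ Z, IsIncoming ε i j (freeFlow τ Z) → recoil ε i j τ Z ∈ M → Z ∈ M)
    (hgen : ∀ W ∉ M, IsGeneric ε t W)
    (hbase : ∀ W ∉ M, freeFlow t W ∈ phaseSpace d (s + 1) ε →
      |φ (s + 1) 0 (freeFlow t W)| ≤ φhat (s + 1) 0 (freeFlow t W))
    (hlow : 1 ≤ s → ∀ W ∉ M, ∀ r : ℚ, 0 ≤ (r : ℝ) → (r : ℝ) ≤ t → ∀ k,
      freeFlow r (removeParticle k W) ∈ phaseSpace d s ε →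
      |φ s (t - r) (freeFlow r (removeParticle k W))|
        ≤ φhat s (t - r) (freeFlow r (removeParticle k W)))
    {Z : Config d (s + 1)} (hZM : Z ∉ M) (hZ : Z ∈ phaseSpace d (s + 1) ε) :
    |φ (s + 1) t Z| ≤ φhat (s + 1) t Z := by
  by_contra hbad
  -- A state is a time and a free trajectory starting there at which the comparison fails. Failure
  -- passes on to the next collision, so one failure would produce infinitely many collisions before
  -- `t`.
  let State := {p : ℝ × Config d (s + 1) // 0 ≤ p.1 ∧ p.1 < t ∧ p.2 ∉ M ∧
    (∃ δ > 0, IsFreeOn ε p.1 (p.1 + δ) p.2) ∧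
    ¬ |φ (s + 1) (t - p.1) (freeFlow p.1 p.2)| ≤ φhat (s + 1) (t - p.1) (freeFlow p.1 p.2)}
  have hnext : ∀ p : State, ∃ q : State, p.1.1 < q.1.1 ∧ ∃ i j,
      IsIncoming ε i j (freeFlow q.1.1 p.1.2) ∧ q.1.2 = recoil ε i j q.1.1 p.1.2 := by
    rintro ⟨⟨T, W⟩, hT, hTt, hWM, ⟨δ, hδ, hfree⟩, hnot⟩
    rcases isFreeOn_or_exists_collision hε (hgen W hWM) hTt hδ hfree with
      ⟨hf, hm⟩ | ⟨τ, i, j, hTτ, hτt, hf, hmem, hin, δ', hδ', hf'⟩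
    · refine absurd ?_ hnot
      have hs' : 1 ≤ s + 1 := Nat.le_add_left 1 s
      simp only
      rw [(hφ.transport (s + 1) hs' hsN).eq_along hf le_rfl hTt.le le_rfl le_rfl,
        (hφhat.transport (s + 1) hs' hsN).eq_along hf le_rfl hTt.le le_rfl le_rfl, sub_self]
      exact hbase W hWM hm
    · have hWM' : recoil ε i j τ W ∉ M := fun h => hWM (hM i j τ W hin h)
      -- A collision needs two distinct particles; a single particle reaches the initial data
      -- freely.
      have hs : 1 ≤ s := by
        have := Fin.val_ne_of_ne hin.1
        omega
      refine ⟨⟨(τ, recoil ε i j τ W), hT.trans hTτ.le, hτt, hWM', ⟨δ', hδ', hf'⟩, fun hpost => ?_⟩,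
        hTτ, i, j, hin, rfl⟩
      refine hnot (comparison_of_recoil hε hφ hφhat hs hsN hT hTτ hτt hδ' hf hmem hin hf' ?_ hpost)
      rintro W' (rfl | rfl)
      · exact hlow hs _ hWM
      · exact hlow hs _ hWM'
  choose next hlt i j hin hrec using hnext
  have hfree0 : ∃ δ > 0, IsFreeOn ε 0 (0 + δ) Z := by
    have h1 : ∀ᶠ u in 𝓝[>] (0 : ℝ), freeFlow u Z ∈ phaseSpace d (s + 1) ε :=
      nhdsWithin_le_nhds ((continuous_freeFlow Z).continuousAt.eventually_mem
        ((isOpen_phaseSpace ε).mem_nhds (by rwa [freeFlow_zero])))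
    obtain ⟨δ, hδ, hsub⟩ := (mem_nhdsGT_iff_exists_Ioo_subset).1 h1
    exact ⟨δ, hδ, fun σ h2 h3 => hsub ⟨h2, by rwa [zero_add] at h3⟩⟩
  let p : ℕ → State := fun n => next^[n] ⟨(0, Z), le_rfl, ht, hZM, hfree0, by simpa using hbad⟩
  have hp : ∀ n, p (n + 1) = next (p n) := fun n => Function.iterate_succ_apply' _ _ _
  refine no_accumulation_of_collisions hε (T := fun n => (p n).1.1) (W := fun n => (p n).1.2)
    (i := fun n => i (p n)) (j := fun n => j (p n)) (b := t)
    (strictMono_nat_of_lt_succ fun n => ?_) (fun n => (p n).2.2.1.le) (fun n => ?_) fun n => ?_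
  · rw [hp]; exact hlt _
  · rw [hp]; exact hin _
  · simp only [hp]; exact hrec _

/-! ### Induction on the number of particles -/

/-- The comparison at the level `s` for all times implies the comparison at the level `s + 1`. -/
theorem comparison_succ [NeZero d] {N : ℕ} {ε : ℝ} {φ φhat : (s : ℕ) → ℝ → Config d s → ℝ}
    (hε : 0 < ε) (hφ : IsDualBBGKYSolution d N ε φ) (hφhat : IsModifiedSolution d N ε φhat)
    (hsN : s + 1 ≤ N)
    (hbase : ∀ᵐ Z : Config d (s + 1), Z ∈ phaseSpace d (s + 1) ε →
      |φ (s + 1) 0 Z| ≤ φhat (s + 1) 0 Z)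
    (hlow : 1 ≤ s → ∀ t : ℝ, 0 ≤ t → ∀ᵐ Z : Config d s, Z ∈ phaseSpace d s ε →
      |φ s t Z| ≤ φhat s t Z) {t : ℝ} (ht : 0 ≤ t) :
    ∀ᵐ Z : Config d (s + 1), Z ∈ phaseSpace d (s + 1) ε → |φ (s + 1) t Z| ≤ φhat (s + 1) t Z := by
  rcases ht.eq_or_lt with rfl | ht
  · exact hbase
  have h1 : ∀ᵐ W : Config d (s + 1), freeFlow t W ∈ phaseSpace d (s + 1) ε →
      |φ (s + 1) 0 (freeFlow t W)| ≤ φhat (s + 1) 0 (freeFlow t W) :=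
    volume_freeFlow_preimage_eq_zero t hbase
  have h2 : ∀ᵐ W : Config d (s + 1), 1 ≤ s → ∀ r : ℚ, 0 ≤ (r : ℝ) → (r : ℝ) ≤ t → ∀ k,
      freeFlow r (removeParticle k W) ∈ phaseSpace d s ε →
      |φ s (t - r) (freeFlow r (removeParticle k W))|
        ≤ φhat s (t - r) (freeFlow r (removeParticle k W)) := by
    -- Only countably many rational times and finitely many removed particles occur, so a single
    -- null set suffices.
    simp only [eventually_imp_distrib_left, ae_all_iff]
    intro hs r _ hr k
    exact volume_removeParticle_preimage_eq_zero k
      (volume_freeFlow_preimage_eq_zero r (hlow hs (t - r) (sub_nonneg.2 hr)))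
  obtain ⟨M, hM0, hNM, hM⟩ := exists_null_superset_closed_under_collisions hε
    (h1.and (h2.and (ae_isGeneric hε t)))
  filter_upwards [measure_eq_zero_iff_ae_notMem.1 hM0] with Z hZM hZ
  have hW := fun W (hWM : W ∉ M) => not_not.1 fun h => hWM (hNM h)
  exact comparison_of_notMem hε hφ hφhat hsN ht hM (fun W h => (hW W h).2.2)
    (fun W h => (hW W h).1) (fun hs W h => (hW W h).2.1 hs) hZM hZ

end HardSphere

theorem mainTheorem6 (d N S : ℕ) (hd : 2 ≤ d) (hS : 1 ≤ S) (hSN : S ≤ N) (ε : ℝ) (hε : 0 < ε)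
    (φ φhat : (s : ℕ) → ℝ → HardSphere.Config d s → ℝ)
    (hφ : HardSphere.IsDualBBGKYSolution d N ε φ)
    (hφhat : HardSphere.IsModifiedSolution d N ε φhat)
    (h0 : ∀ s : ℕ, 1 ≤ s → s ≤ S →
      ∀ᵐ Z ∂(MeasureTheory.volume : MeasureTheory.Measure (HardSphere.Config d s)),
        Z ∈ HardSphere.phaseSpace d s ε → |φ s 0 Z| ≤ φhat s 0 Z) :
    ∀ t : ℝ, 0 ≤ t → ∀ s : ℕ, 1 ≤ s → s ≤ S →
      ∀ᵐ Z ∂(MeasureTheory.volume : MeasureTheory.Measure (HardSphere.Config d s)),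
        Z ∈ HardSphere.phaseSpace d s ε → |φ s t Z| ≤ φhat s t Z := by
  have : NeZero d := ⟨by omega⟩
  have key : ∀ s : ℕ, 1 ≤ s → s ≤ S → ∀ t : ℝ, 0 ≤ t → ∀ᵐ Z : HardSphere.Config d s,
      Z ∈ HardSphere.phaseSpace d s ε → |φ s t Z| ≤ φhat s t Z := by
    intro s
    induction s with
    | zero => intro h; omega
    | succ s ih =>
      intro hs hsS t ht
      exact HardSphere.comparison_succ hε hφ hφhat (hsS.trans hSN) (h0 _ hs hsS)
        (fun h => ih h (Nat.le_of_succ_le hsS)) ht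
  exact fun t ht s hs hsS => key s hs hsS t ht
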